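/- Let $N$ be the set of simple counting measures on the Borel sets of $\mathbb{R}^2$ (finite, integer-valued on bounded Borel sets, with mass at most $1$ at each point), with the $\sigma$-algebra $\mathcal{N}$ generated by the events $\{\omega : \omega(A)=k\}$, $A$ Borel, $k$ an integer. For $t\in\mathbb{R}^2$ let $S_t:N\to N$ be the translation $(S_t\omega)(A)=\omega(A-t)$. Let $\lambda_p,\lambda_s\ge 0$, let $P_p$ and $P_s$ be probability measures on $(N,\mathcal{N})$ that are the laws of homogeneous Poisson point processes on $\mathbb{R}^2$ with densities $\lambda_p$ and $\lambda_s$ respectively, and let $\tilde P=P_p\times P_s$ be the product measure on $N\times N$, i.e. the joint law of two independent such processes. For $z\in\mathbb{Z}^2$ put $\tilde T_z(\omega_p,\omega_s)=(S_z\omega_p,S_z\omega_s)$. Then the action $\{\tilde T_z: z\in\mathbb{Z}^2\}$ of $\mathbb{Z}^2$ on $(N\times N,\tilde P)$ is ergodic: each $\tilde T_z$ preserves $\tilde P$, and every measurable event $E$ with $\tilde P(\tilde T_z^{-1}E\,\triangle\,E)=0$ for all $z\in\mathbb{Z}^2$ (in particular every invariant event) has $\tilde P(E)\in\{0,1\}$.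 Moreover, each of the two unit translations $\tilde T_{e_1}$, $\tilde T_{e_2}$ is by itself an ergodic transformation of $(N\times N,\tilde P)$. -/

import Mathlib

open MeasureTheory ProbabilityTheory
open scoped NNReal ENNReal

noncomputable section

/-- The Euclidean plane `ℝ²` (its `volume` is Lebesgue measure). -/
abbrev Plane : Type := EuclideanSpace ℝ (Fin 2)

/-- A simple counting measure on the Borel sets of the plane: it takes a (finite) natural number
as its value on every bounded Borel set, and it gives mass at most one to every point. -/
@[ext]
structure PointConfig where
  toMeasure : Measure Plane
  exists_nat_of_isBounded : ∀ A : Set Plane, MeasurableSet A → Bornology.IsBounded A →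
    ∃ k : ℕ, toMeasure A = k
  measure_singleton_le_one : ∀ x : Plane, toMeasure {x} ≤ 1

namespace PointConfig

/-- The σ-algebra generated by the events `{ω : ω(A) = k}`, `A` Borel, `k` an integer. -/
instance instMeasurableSpace : MeasurableSpace PointConfig :=
  MeasurableSpace.generateFrom
    {S | ∃ A : Set Plane, MeasurableSet A ∧ ∃ k : ℕ, S = {ω : PointConfig | ω.toMeasure A = k}}

/-- The transformation `S_t` induced by the translation `T_t x = x + t` of the plane:
`(S_t ω)(A) = ω(T_t⁻¹ A)` for Borel sets `A`. -/
def translate (t : Plane) (ω : PointConfig) : PointConfig where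
  toMeasure := ω.toMeasure.map (fun x => x + t)
  exists_nat_of_isBounded := by
    intro A hA hb
    rw [Measure.map_apply (measurable_add_const t) hA]
    refine ω.exists_nat_of_isBounded _ (measurable_add_const t hA) ?_
    obtain ⟨R, hR⟩ := hb.exists_norm_le
    refine isBounded_iff_forall_norm_le.2 ⟨R + ‖t‖, fun x hx => ?_⟩
    have h1 : ‖x‖ ≤ ‖x + t‖ + ‖t‖ := by
      simpa using norm_sub_le (x + t) t
    linarith [hR (x + t) hx]
  measure_singleton_le_one := by
    intro x
    rw [Measure.map_apply (measurable_add_const t) (measurableSet_singleton x)]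
    have h : (fun y : Plane => y + t) ⁻¹' {x} = {x - t} := by
      ext y
      exact eq_sub_iff_add_eq.symm
    rw [h]
    exact ω.measure_singleton_le_one _

theorem translate_apply (t : Plane) (ω : PointConfig) {A : Set Plane} (hA : MeasurableSet A) :
    (translate t ω).toMeasure A = ω.toMeasure ((fun x => x + t) ⁻¹' A) :=
  Measure.map_apply (measurable_add_const t) hA

/-- The vector of `ℝ²` with the integer coordinates `z`. -/
def latticePoint (z : Fin 2 → ℤ) : Plane := WithLp.toLp 2 (fun i => (z i : ℝ))

/-- The group `ℤ²` acts on configurations by integer translations, `z +ᵥ ω = S_z ω`. On pairs of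
configurations it acts componentwise, `z +ᵥ (ω₁, ω₂) = (S_z ω₁, S_z ω₂)`. -/
instance instAddAction : AddAction (Fin 2 → ℤ) PointConfig where
  vadd z ω := translate (latticePoint z) ω
  zero_vadd ω := by
    have h : latticePoint 0 = 0 := by
      ext i
      simp [latticePoint]
    change translate (latticePoint 0) ω = ω
    rw [h]
    ext1
    simp [translate]
  add_vadd z w ω := by
    have h : latticePoint (z + w) = latticePoint w + latticePoint z := by
      ext i
      simp [latticePoint, add_comm]
    change translate (latticePoint (z + w)) ω
      = translate (latticePoint z) (translate (latticePoint w) ω)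
    rw [h]
    ext1
    simp only [translate]
    rw [Measure.map_map (measurable_add_const _) (measurable_add_const _)]
    congr 1
    funext x
    simp [add_assoc]

end PointConfig

/-- `P` is the law of a homogeneous Poisson point process of density `l` on the plane: the number
of points in a bounded Borel set `A` has the Poisson distribution with mean `l * |A|`, and the
numbers of points in finitely many pairwise disjoint Borel sets are independent. -/
structure IsPoissonPointProcess (l : ℝ≥0) (P : Measure PointConfig) : Prop where
  measure_count_eq : ∀ A : Set Plane, MeasurableSet A → Bornology.IsBounded A → ∀ k : ℕ,
    P {ω | ω.toMeasure A = k} = poissonMeasure (l * (volume A).toNNReal) {k}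
  iIndepFun_count : ∀ (n : ℕ) (A : Fin n → Set Plane), (∀ i, MeasurableSet (A i)) →
    Pairwise (fun i j => Disjoint (A i) (A j)) →
    iIndepFun (fun (i : Fin n) (ω : PointConfig) => ω.toMeasure (A i)) P

end

/-! Mixing argument. Every event is approximated in measure by an event `A` depending only on the
points in a large ball. A long enough translation carries the ball off itself, so `A` and its
translate are independent, with common probability `a`, and their intersection has probability `a²`.
If `E` is invariant, both approximate `E`, hence so does their intersection, and in the limit `P(E)
= P(E)²`. This is `ergodic_of_indep_comap_iterate`.

Two facts about Poisson processes feed it. Disjoint regions carry independent σ-algebras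
(`indep_sigmaIn`), which passes to products by `Indep.prod`. Translations preserve the law, because
the translated process is again Poisson of the same density and the density determines the law
(`unique`). Both reduce overlapping sets to the disjoint atoms they generate.

Only powers of one unit translation are used, so each generator is ergodic, and the `ℤ²`-action
inherits this. -/

open Filter Set

/-! ### Ergodicity from asymptotic independence -/

section Ergodic

variable {Ω : Type*}

/-- The sets that are measurable for some member of a monotone sequence of σ-algebras
form a ring. -/
theorem isSetRing_exists_measurableSet {F : ℕ → MeasurableSpace Ω} (hF : Monotone F) :
    IsSetRing {s | ∃ n, MeasurableSet[F n] s} where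
  empty_mem := ⟨0, @MeasurableSet.empty _ (F 0)⟩
  union_mem := by
    rintro s t ⟨n, hs⟩ ⟨m, ht⟩
    exact ⟨max n m, @MeasurableSet.union _ (F (max n m)) _ _ (hF (le_max_left n m) _ hs)
      (hF (le_max_right n m) _ ht)⟩
  sdiff_mem := by
    rintro s t ⟨n, hs⟩ ⟨m, ht⟩
    exact ⟨max n m, @MeasurableSet.diff _ (F (max n m)) _ _ (hF (le_max_left n m) _ hs)
      (hF (le_max_right n m) _ ht)⟩

theorem eq_generateFrom_exists_measurableSet {mΩ : MeasurableSpace Ω} {F : ℕ → MeasurableSpace Ω}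
    (hsup : ⨆ n, F n = mΩ) :
    mΩ = MeasurableSpace.generateFrom {s | ∃ n, MeasurableSet[F n] s} := by
  rw [← hsup, MeasurableSpace.measurableSpace_iSup_eq]

open scoped symmDiff in
/-- Let `F` be a monotone sequence of σ-algebras that generates the whole σ-algebra. If for each
`n` some iterate of a measure preserving map makes `F n` independent of itself, then the map is
ergodic. -/
theorem MeasureTheory.MeasurePreserving.ergodic_of_indep_comap_iterate {mΩ : MeasurableSpace Ω}
    {μ : Measure Ω} [IsProbabilityMeasure μ] {T : Ω → Ω} (hT : MeasurePreserving T μ μ)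
    {F : ℕ → MeasurableSpace Ω} (hF : Monotone F) (hsup : ⨆ n, F n = mΩ)
    (hind : ∀ n, ∃ k, Indep (F n) ((F n).comap T^[k]) μ) : Ergodic T μ := by
  refine ⟨hT, ⟨fun E hE hTE => ?_⟩⟩
  have hle : ∀ n, F n ≤ mΩ := fun n => hsup ▸ le_iSup F n
  -- Of the `4 * ε`, half bounds the distance from `μ (A ∩ T⁻ᵏ A)` to `μ E`; the other half bounds
  -- `|(μ A)² - (μ E)²|`, both measures lying in `[0, 1]`.
  have key : ∀ ε : ℝ, 0 < ε → |μ.real E - μ.real E * μ.real E| ≤ 4 * ε := by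
    intro ε hε
    obtain ⟨A, ⟨n, hAn⟩, hAE⟩ := exists_measure_symmDiff_lt_of_generateFrom_isSetRing (μ := μ)
      (isSetRing_exists_measurableSet hF)
      ⟨{univ}, countable_singleton _, by
        rintro _ rfl
        exact ⟨0, @MeasurableSet.univ _ (F 0)⟩, by simp⟩
      (eq_generateFrom_exists_measurableSet hsup) hE (ENNReal.ofReal_pos.2 hε)
    have hA : MeasurableSet A := hle n _ hAn
    obtain ⟨k, hk⟩ := hind n
    have hTk := hT.iterate k
    have hTkE : T^[k] ⁻¹' E = E := Function.IsFixedPt.preimage_iterate hTE k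
    have hAE' : μ.real (A ∆ E) ≤ ε := ENNReal.toReal_le_of_le_ofReal hε.le hAE.le
    have hAE'' : μ.real ((T^[k] ⁻¹' A) ∆ E) ≤ ε := by
      have h : (T^[k] ⁻¹' A) ∆ E = T^[k] ⁻¹' (A ∆ E) := by
        rw [preimage_symmDiff, hTkE]
      rw [h, measureReal_def, hTk.measure_preimage (hA.symmDiff hE).nullMeasurableSet]
      exact hAE'
    have hprod : μ.real (A ∩ T^[k] ⁻¹' A) = μ.real A * μ.real A := by
      have h := (Indep_iff _ _ μ).1 hk A (T^[k] ⁻¹' A) hAn ⟨A, hAn, rfl⟩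
      rw [measureReal_def, h, ENNReal.toReal_mul, hTk.measure_preimage hA.nullMeasurableSet]
      rfl
    have h1 : |μ.real (A ∩ T^[k] ⁻¹' A) - μ.real E| ≤ ε + ε := by
      refine (abs_measureReal_sub_le_measureReal_symmDiff
        (hA.inter (hTk.measurable hA)).nullMeasurableSet hE.nullMeasurableSet).trans ?_
      refine le_trans (measureReal_mono (s₂ := A ∆ E ∪ (T^[k] ⁻¹' A) ∆ E) ?_) <|
        (measureReal_union_le _ _).trans (add_le_add hAE' hAE'')
      intro x hx
      simp only [mem_symmDiff, mem_union, mem_inter_iff] at hx ⊢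
      tauto
    have h2 : |μ.real A - μ.real E| ≤ ε :=
      (abs_measureReal_sub_le_measureReal_symmDiff hA.nullMeasurableSet
        hE.nullMeasurableSet).trans hAE'
    have hA0 : 0 ≤ μ.real A := measureReal_nonneg
    have hA1 : μ.real A ≤ 1 := measureReal_le_one
    have hE0 : 0 ≤ μ.real E := measureReal_nonneg
    have hE1 : μ.real E ≤ 1 := measureReal_le_one
    rw [hprod] at h1
    rw [abs_le] at h1 h2 ⊢
    constructor <;> nlinarith
  have hp : μ.real E = μ.real E * μ.real E := by
    rw [← sub_eq_zero, ← abs_nonpos_iff]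
    refine le_of_forall_pos_le_add fun ε hε => ?_
    linarith [key (ε / 4) (by positivity)]
  rw [eventuallyConst_set']
  have hp' : μ.real E * (1 - μ.real E) = 0 := by linarith
  rcases mul_eq_zero.1 hp' with h | h
  · left
    rw [ae_eq_empty]
    exact (measureReal_eq_zero_iff).1 h
  · right
    rw [ae_eq_univ, prob_compl_eq_zero_iff hE]
    have h1 : μ.real E = 1 := by linarith
    rwa [measureReal_def, ENNReal.toReal_eq_one_iff] at h1

end Ergodic

/-! ### Product σ-algebras -/

section Prod

variable {α β : Type*}

/-- Products of independent σ-algebras are independent for the product measure. -/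
theorem ProbabilityTheory.Indep.prod {m₁ m₂ mα : MeasurableSpace α}
    {n₁ n₂ mβ : MeasurableSpace β} {μ : Measure α} {ν : Measure β} [IsProbabilityMeasure μ]
    [IsProbabilityMeasure ν]
    (hm₁ : m₁ ≤ mα) (hm₂ : m₂ ≤ mα) (hn₁ : n₁ ≤ mβ) (hn₂ : n₂ ≤ mβ)
    (hm : Indep m₁ m₂ μ) (hn : Indep n₁ n₂ ν) :
    Indep (m₁.prod n₁) (m₂.prod n₂) (μ.prod ν) := by
  have hle : ∀ {m : MeasurableSpace α} {n : MeasurableSpace β}, m ≤ mα → n ≤ mβ →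
      m.prod n ≤ mα.prod mβ := fun h h' =>
    sup_le_sup (MeasurableSpace.comap_mono h) (MeasurableSpace.comap_mono h')
  refine IndepSets.indep (hle hm₁ hn₁) (hle hm₂ hn₂) (@isPiSystem_prod _ _ m₁ n₁)
    (@isPiSystem_prod _ _ m₂ n₂) (@generateFrom_prod _ _ m₁ n₁).symm
    (@generateFrom_prod _ _ m₂ n₂).symm ?_
  rw [IndepSets_iff]
  rintro _ _ ⟨s, hs, t, ht, rfl⟩ ⟨s', hs', t', ht', rfl⟩
  rw [prod_inter_prod, Measure.prod_prod, Measure.prod_prod, Measure.prod_prod,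
    (Indep_iff _ _ μ).1 hm s s' hs hs', (Indep_iff _ _ ν).1 hn t t' ht ht']
  ring

theorem MeasurableSpace.iSup_prod {F : ℕ → MeasurableSpace α} {G : ℕ → MeasurableSpace β} :
    ⨆ n, (F n).prod (G n) = (⨆ n, F n).prod (⨆ n, G n) := by
  simp only [MeasurableSpace.prod, MeasurableSpace.comap_iSup, iSup_sup_eq]

end Prod

/-! ### Atoms of a finite family of sets -/

section Atoms

variable {X ι : Type*}

/-- The points of `B` that belong to exactly those members of the family `A` whose index is
in `s`. -/
def atomIn (B : Set X) (A : ι → Set X) (s : Set ι) : Set X := B ∩ {x | {i | x ∈ A i} = s}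

theorem atomIn_subset (B : Set X) (A : ι → Set X) (s : Set ι) : atomIn B A s ⊆ B :=
  inter_subset_left

theorem pairwise_disjoint_atomIn (B : Set X) (A : ι → Set X) :
    Pairwise fun s t => Disjoint (atomIn B A s) (atomIn B A t) := fun _ _ hst =>
  disjoint_left.2 fun _ hs ht => hst (hs.2.symm.trans ht.2)

theorem MeasurableSet.atomIn [MeasurableSpace X] [Finite ι] {B : Set X} {A : ι → Set X}
    (hB : MeasurableSet B) (hA : ∀ i, MeasurableSet (A i)) (s : Set ι) :
    MeasurableSet (atomIn B A s) := by
  refine hB.inter ?_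
  have h : {x | {i | x ∈ A i} = s} = ⋂ i, {x | x ∈ A i ↔ i ∈ s} := by
    ext x
    simp [Set.ext_iff]
  rw [h]
  refine MeasurableSet.iInter fun i => ?_
  by_cases hi : i ∈ s
  · simpa [hi] using hA i
  · simp only [hi, iff_false]
    exact (hA i).compl

-- Makes counts in overlapping sets measurable functions of counts in disjoint ones, the only counts
-- whose joint law is prescribed.
open Classical in
theorem MeasureTheory.Measure.eq_sum_atomIn [MeasurableSpace X] [Fintype ι] (μ : Measure X)
    {B : Set X} {A : ι → Set X} (hB : MeasurableSet B) (hA : ∀ i, MeasurableSet (A i))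
    (hAB : ∀ i, A i ⊆ B) (i : ι) :
    μ (A i) = ∑ s : Set ι, if i ∈ s then μ (atomIn B A s) else 0 := by
  have h : A i = ⋃ s ∈ Finset.univ.filter (fun s : Set ι => i ∈ s), atomIn B A s := by
    ext x
    simp only [atomIn, Finset.mem_filter, Finset.mem_univ, true_and, mem_iUnion, mem_inter_iff,
      mem_ofPred_eq, exists_prop]
    refine ⟨fun hx => ⟨_, hx, hAB i hx, rfl⟩, ?_⟩
    rintro ⟨_, hi, -, rfl⟩
    exact hi
  rw [← Finset.sum_filter]
  nth_rw 1 [h]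
  exact measure_biUnion_finset (fun s _ t _ hst => pairwise_disjoint_atomIn B A hst)
    fun s _ => hB.atomIn hA s

end Atoms

/-! ### Local σ-algebras of configurations -/

namespace PointConfig

/-- The number of points of a configuration in a bounded Borel set, as a measurable function with
values in the natural numbers. -/
theorem exists_measurable_nat {A : Set Plane} (hA : MeasurableSet A) (hb : Bornology.IsBounded A) :
    ∃ N : PointConfig → ℕ, Measurable N ∧ ∀ ω, ω.toMeasure A = N ω := by
  choose N hN using fun ω : PointConfig => ω.exists_nat_of_isBounded A hA hb
  refine ⟨N, measurable_to_countable' fun k => ?_, hN⟩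
  refine MeasurableSpace.measurableSet_generateFrom ⟨A, hA, k, ?_⟩
  ext ω
  simp [hN]

/-- The numbers of points of a configuration in the Borel subsets of `B`. -/
def countsIn (B : Set Plane) (ω : PointConfig) (A : {A : Set Plane // MeasurableSet A ∧ A ⊆ B}) :
    ℝ≥0∞ :=
  ω.toMeasure A

/-- The σ-algebra of events that depend only on the points inside `B`. -/
@[reducible]
def sigmaIn (B : Set Plane) : MeasurableSpace PointConfig :=
  MeasurableSpace.comap (countsIn B) inferInstance

theorem measurable_sigmaIn {A B : Set Plane} (hA : MeasurableSet A) (hAB : A ⊆ B) :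
    Measurable[sigmaIn B] fun ω : PointConfig => ω.toMeasure A :=
  (measurable_pi_apply
    (⟨A, hA, hAB⟩ : {A : Set Plane // MeasurableSet A ∧ A ⊆ B})).comp
      (comap_measurable (countsIn B))

/-- Counts may be infinite on unbounded sets; exhausting by balls reduces them to bounded sets. -/
theorem measure_eq_iSup_ball (μ : Measure Plane) (A : Set Plane) :
    μ A = ⨆ n : ℕ, μ (A ∩ Metric.ball 0 n) := by
  have hm : Monotone fun n : ℕ => A ∩ Metric.ball (0 : Plane) n := fun m n h =>
    inter_subset_inter_right _ (Metric.ball_subset_ball (by exact_mod_cast h))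
  rw [← hm.measure_iUnion, ← inter_iUnion, Metric.iUnion_ball_nat, inter_univ]

theorem measurable_count {A : Set Plane} (hA : MeasurableSet A) :
    Measurable fun ω : PointConfig => ω.toMeasure A := by
  simp_rw [measure_eq_iSup_ball _ A]
  refine Measurable.iSup fun n => ?_
  obtain ⟨N, hN, h⟩ := exists_measurable_nat (hA.inter Metric.isOpen_ball.measurableSet)
    (Metric.isBounded_ball.subset (inter_subset_right (s := A) (t := Metric.ball 0 (n : ℝ))))
  simp_rw [h]
  exact measurable_from_top.comp hN

theorem measurable_countsIn (B : Set Plane) : Measurable (countsIn B) :=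
  measurable_pi_lambda _ fun A => measurable_count A.2.1

theorem sigmaIn_le (B : Set Plane) : sigmaIn B ≤ instMeasurableSpace :=
  (measurable_countsIn B).comap_le

theorem measurable_sigmaIn_iff {Ω : Type*} {m : MeasurableSpace Ω} {f : Ω → PointConfig}
    {B : Set Plane} : Measurable[m, sigmaIn B] f ↔
      ∀ A, MeasurableSet A → A ⊆ B → Measurable fun x => (f x).toMeasure A := by
  rw [sigmaIn, measurable_comap_iff, measurable_pi_iff]
  exact ⟨fun h A hA hAB => h ⟨A, hA, hAB⟩, fun h A => h A A.2.1 A.2.2⟩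

theorem sigmaIn_mono {B C : Set Plane} (h : B ⊆ C) : sigmaIn B ≤ sigmaIn C := by
  have hid : Measurable[sigmaIn C, sigmaIn B] id :=
    measurable_sigmaIn_iff.2 fun A hA hAB => measurable_sigmaIn hA (hAB.trans h)
  exact fun s hs => hid hs

theorem iSup_sigmaIn_ball :
    ⨆ n : ℕ, sigmaIn (Metric.ball 0 n) = instMeasurableSpace := by
  refine le_antisymm (iSup_le fun n => sigmaIn_le _) (MeasurableSpace.generateFrom_le ?_)
  rintro _ ⟨A, hA, k, rfl⟩
  have h : Measurable[⨆ n : ℕ, sigmaIn (Metric.ball 0 n)]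
      fun ω : PointConfig => ω.toMeasure A := by
    simp_rw [measure_eq_iSup_ball _ A]
    refine Measurable.iSup fun n => ?_
    exact (measurable_sigmaIn (hA.inter Metric.isOpen_ball.measurableSet)
      inter_subset_right).mono (le_iSup (fun n : ℕ => sigmaIn (Metric.ball 0 n)) n) le_rfl
  exact h (measurableSet_singleton _)

theorem comap_translate_sigmaIn_le (t : Plane) (B : Set Plane) :
    (sigmaIn B).comap (translate t) ≤ sigmaIn ((fun x => x + t) ⁻¹' B) := by
  rw [← measurable_iff_comap_le, measurable_sigmaIn_iff]
  intro A hA hAB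
  simp_rw [translate_apply t _ hA]
  exact measurable_sigmaIn (measurable_add_const t hA) (preimage_mono hAB)

theorem measurable_translate (t : Plane) : Measurable (translate t) := by
  refine measurable_generateFrom ?_
  rintro _ ⟨A, hA, k, rfl⟩
  simp_rw [preimage_ofPred_eq, translate_apply t _ hA]
  exact measurable_count (measurable_add_const t hA) (measurableSet_singleton _)

end PointConfig

/-! ### Independence, uniqueness and translation invariance -/

namespace IsPoissonPointProcess

open PointConfig

variable {l : ℝ≥0} {P Q : Measure PointConfig}

theorem map_count (hP : IsPoissonPointProcess l P) {A : Set Plane} (hA : MeasurableSet A)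
    (hb : Bornology.IsBounded A) :
    P.map (fun ω => ω.toMeasure A)
      = (poissonMeasure (l * (volume A).toNNReal)).map (Nat.cast : ℕ → ℝ≥0∞) := by
  obtain ⟨N, hN, h⟩ := exists_measurable_nat hA hb
  have hcount := hP.measure_count_eq A hA hb
  simp_rw [h, Nat.cast_inj] at hcount ⊢
  have hlaw : P.map N = poissonMeasure (l * (volume A).toNNReal) := by
    refine Measure.ext_of_singleton fun k => ?_
    rw [Measure.map_apply hN (measurableSet_singleton k), ← hcount k]
    rfl
  rw [← hlaw, Measure.map_map measurable_from_top hN]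
  rfl

theorem iIndepFun_count_of_finite (hP : IsPoissonPointProcess l P) {κ : Type*} [Finite κ]
    {A : κ → Set Plane} (hA : ∀ i, MeasurableSet (A i))
    (hd : Pairwise fun i j => Disjoint (A i) (A j)) :
    iIndepFun (fun i (ω : PointConfig) => ω.toMeasure (A i)) P := by
  obtain ⟨n, ⟨e⟩⟩ := Finite.exists_equiv_fin κ
  have h := (hP.iIndepFun_count n (fun i => A (e.symm i)) (fun i => hA _)
    fun i j hij => hd (e.symm.injective.ne hij)).precomp e.injective
  simpa using h

open Classical in
/-- Events that depend only on the points inside disjoint sets are independent. -/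
theorem indep_sigmaIn [IsProbabilityMeasure P] (hP : IsPoissonPointProcess l P) {B C : Set Plane}
    (hB : MeasurableSet B) (hC : MeasurableSet C) (hBC : Disjoint B C) :
    Indep (sigmaIn B) (sigmaIn C) P := by
  change IndepFun (countsIn B) (countsIn C) P
  refine IndepFun.process_indepFun_process (X := fun A ω => countsIn B ω A)
    (Y := fun A ω => countsIn C ω A) (fun A => measurable_count A.2.1)
    (fun A => measurable_count A.2.1) fun I J => ?_
  let a : I → Set Plane := fun A => A.1.1
  let b : J → Set Plane := fun A => A.1.1
  have ha : ∀ i, MeasurableSet (a i) := fun i => i.1.2.1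
  have hb : ∀ i, MeasurableSet (b i) := fun i => i.1.2.1
  -- As `B` and `C` are disjoint, the atoms of both finite families form a single disjoint family,
  -- so their counts are jointly independent; grouping them by side gives the claim.
  let c : Set I ⊕ Set J → Set Plane := Sum.elim (atomIn B a) (atomIn C b)
  have hc : ∀ s, MeasurableSet (c s) := by
    rintro (s | s)
    · exact hB.atomIn ha s
    · exact hC.atomIn hb s
  have hd : Pairwise fun s t => Disjoint (c s) (c t) := by
    rintro (s | s) (t | t) hst
    · exact pairwise_disjoint_atomIn B a (fun h => hst (congrArg _ h))
    · exact hBC.mono (atomIn_subset _ _ _) (atomIn_subset _ _ _)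
    · exact hBC.symm.mono (atomIn_subset _ _ _) (atomIn_subset _ _ _)
    · exact pairwise_disjoint_atomIn C b (fun h => hst (congrArg _ h))
  have hi := (hP.iIndepFun_count_of_finite hc hd).indepFun_finset
    (Finset.univ.map Function.Embedding.inl) (Finset.univ.map Function.Embedding.inr)
    (by simp [Finset.disjoint_left]) fun s => measurable_count (hc s)
  have hcomp := hi.comp
    (φ := fun (f : _ → ℝ≥0∞) (i : I) =>
      ∑ s : Set I, if i ∈ s then f ⟨Sum.inl s, by simp⟩ else 0)
    (ψ := fun (f : _ → ℝ≥0∞) (j : J) =>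
      ∑ s : Set J, if j ∈ s then f ⟨Sum.inr s, by simp⟩ else 0)
    (measurable_pi_lambda _ fun i => Finset.measurable_sum _ fun s _ =>
      Measurable.ite (.const _) (measurable_pi_apply _) measurable_const)
    (measurable_pi_lambda _ fun i => Finset.measurable_sum _ fun s _ =>
      Measurable.ite (.const _) (measurable_pi_apply _) measurable_const)
  convert! hcomp using 1
  · funext ω i
    exact ω.toMeasure.eq_sum_atomIn hB ha (fun i => i.1.2.2) i
  · funext ω j
    exact ω.toMeasure.eq_sum_atomIn hC hb (fun i => i.1.2.2) j

-- The finite-dimensional marginals determine the law of the counts, and each is the image, under a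
-- fixed map, of a product of Poisson laws attached to the atoms.
open Classical in
theorem map_countsIn_eq [IsProbabilityMeasure P] [IsProbabilityMeasure Q]
    (hP : IsPoissonPointProcess l P) (hQ : IsPoissonPointProcess l Q) {B : Set Plane}
    (hB : MeasurableSet B) (hb : Bornology.IsBounded B) :
    P.map (countsIn B) = Q.map (countsIn B) := by
  have hW := measurable_countsIn B
  refine IsProjectiveLimit.unique (P := fun I => (P.map (countsIn B)).map I.restrict)
    (fun I => rfl) fun I => ?_
  let a : I → Set Plane := fun A => A.1.1
  have ha : ∀ i, MeasurableSet (a i) := fun i => i.1.2.1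
  let φ : (Set I → ℝ≥0∞) → I → ℝ≥0∞ := fun f i => ∑ s : Set I, if i ∈ s then f s else 0
  have hφ : Measurable φ := measurable_pi_lambda _ fun i => Finset.measurable_sum _ fun s _ =>
    Measurable.ite (.const _) (measurable_pi_apply _) measurable_const
  have hm : ∀ s, Measurable fun ω : PointConfig => ω.toMeasure (atomIn B a s) :=
    fun s => measurable_count (hB.atomIn ha s)
  have hφeq : I.restrict ∘ countsIn B
      = φ ∘ fun (ω : PointConfig) s => ω.toMeasure (atomIn B a s) := by
    funext ω i
    exact ω.toMeasure.eq_sum_atomIn hB ha (fun i => i.1.2.2) i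
  have hatoms : ∀ {R : Measure PointConfig} [IsProbabilityMeasure R],
      IsPoissonPointProcess l R → R.map (fun (ω : PointConfig) s => ω.toMeasure (atomIn B a s))
        = Measure.pi fun s : Set I => (poissonMeasure (l * (volume (atomIn B a s)).toNNReal)).map
          (Nat.cast : ℕ → ℝ≥0∞) := by
    intro R _ hR
    rw [(iIndepFun_iff_map_fun_eq_pi_map fun s => (hm s).aemeasurable).1
      (hR.iIndepFun_count_of_finite (fun s => hB.atomIn ha s) (pairwise_disjoint_atomIn B a))]
    congr 1
    funext s
    exact hR.map_count (hB.atomIn ha s) (hb.subset (atomIn_subset _ _ _))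
  have hr : Measurable (I.restrict (π := fun _ => ℝ≥0∞)) := by fun_prop
  change (Q.map (countsIn B)).map I.restrict = (P.map (countsIn B)).map I.restrict
  rw [Measure.map_map hr hW, Measure.map_map hr hW, hφeq,
    ← Measure.map_map hφ (measurable_pi_lambda _ hm),
    ← Measure.map_map hφ (measurable_pi_lambda _ hm), hatoms hP,
    hatoms hQ]

/-- The law of a homogeneous Poisson point process is determined by its density. -/
theorem unique [IsProbabilityMeasure P] [IsProbabilityMeasure Q]
    (hP : IsPoissonPointProcess l P) (hQ : IsPoissonPointProcess l Q) : P = Q := by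
  have hmono : Monotone fun n : ℕ => sigmaIn (Metric.ball 0 n) := fun m n h =>
    sigmaIn_mono (Metric.ball_subset_ball (by exact_mod_cast h))
  refine ext_of_generate_finite _ (eq_generateFrom_exists_measurableSet iSup_sigmaIn_ball)
    (isSetRing_exists_measurableSet hmono).isSetSemiring.isPiSystem ?_ (by simp)
  rintro _ ⟨n, S, hS, rfl⟩
  have hW := measurable_countsIn (Metric.ball 0 n)
  rw [← Measure.map_apply hW hS, ← Measure.map_apply hW hS,
    hP.map_countsIn_eq hQ Metric.isOpen_ball.measurableSet Metric.isBounded_ball]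

theorem map_translate (hP : IsPoissonPointProcess l P) [IsProbabilityMeasure P] (t : Plane) :
    IsPoissonPointProcess l (P.map (PointConfig.translate t)) where
  measure_count_eq A hA hb k := by
    have hS : MeasurableSet {ω : PointConfig | ω.toMeasure A = k} :=
      measurable_count hA (measurableSet_singleton _)
    rw [Measure.map_apply (measurable_translate t) hS]
    simp_rw [preimage_ofPred_eq, translate_apply t _ hA]
    rw [hP.measure_count_eq _ (measurable_add_const t hA) ?_ k, measure_preimage_add_right]
    obtain ⟨R, hR⟩ := hb.exists_norm_le
    refine isBounded_iff_forall_norm_le.2 ⟨R + ‖t‖, fun x hx => ?_⟩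
    have h1 : ‖x‖ ≤ ‖x + t‖ + ‖t‖ := by
      simpa using norm_sub_le (x + t) t
    linarith [hR (x + t) hx]
  iIndepFun_count n A hA hd := by
    have := (measurable_translate t).aemeasurable (μ := P)
    have := Measure.isProbabilityMeasure_map this
    have h := hP.iIndepFun_count n (fun i => (fun x => x + t) ⁻¹' A i)
      (fun i => measurable_add_const t (hA i)) fun i j hij => (hd hij).preimage _
    rw [iIndepFun_iff_map_fun_eq_pi_map fun i =>
      (measurable_count (measurable_add_const t (hA i))).aemeasurable] at h
    rw [iIndepFun_iff_map_fun_eq_pi_map fun i => (measurable_count (hA i)).aemeasurable,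
      Measure.map_map (measurable_pi_lambda _ fun i => measurable_count (hA i))
        (measurable_translate t)]
    simp_rw [Measure.map_map (measurable_count (hA _)) (measurable_translate t),
      Function.comp_def, translate_apply t _ (hA _)]
    exact h

theorem measurePreserving_translate (hP : IsPoissonPointProcess l P) [IsProbabilityMeasure P]
    (t : Plane) : MeasurePreserving (PointConfig.translate t) P P := by
  have := Measure.isProbabilityMeasure_map (μ := P) (measurable_translate t).aemeasurable
  exact ⟨measurable_translate t, (hP.map_translate t).unique hP⟩

end IsPoissonPointProcess

/-! ### Separating balls by lattice translations -/

namespace PointConfig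

theorem norm_latticePoint_nsmul_single (k : ℕ) (i : Fin 2) :
    ‖latticePoint (k • Pi.single i 1)‖ = k := by
  have h : latticePoint (k • Pi.single i 1) = EuclideanSpace.single i (k : ℝ) := by
    ext j
    by_cases hj : j = i
    · subst hj
      simp [latticePoint]
    · simp [latticePoint, hj]
  rw [h]
  simp

theorem disjoint_ball_preimage_add_const {r : ℝ} {t : Plane} (ht : 2 * r ≤ ‖t‖) :
    Disjoint (Metric.ball 0 r) ((fun x => x + t) ⁻¹' Metric.ball 0 r) := by
  refine disjoint_left.2 fun x hx hxt => ?_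
  simp only [mem_preimage, mem_ball_zero_iff] at hx hxt
  have h := norm_sub_le (x + t) x
  rw [add_sub_cancel_left] at h
  linarith

theorem vadd_prod_eq_map (z : Fin 2 → ℤ) :
    (fun ω : PointConfig × PointConfig => z +ᵥ ω)
      = Prod.map (PointConfig.translate (latticePoint z))
        (PointConfig.translate (latticePoint z)) :=
  rfl

end PointConfig

namespace IsPoissonPointProcess

open PointConfig

variable {l l' : ℝ≥0} {P Q : Measure PointConfig} [IsProbabilityMeasure P]
  [IsProbabilityMeasure Q]

theorem indep_sigmaIn_comap_translate (hP : IsPoissonPointProcess l P) {r : ℝ} {t : Plane}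
    (ht : 2 * r ≤ ‖t‖) :
    Indep (sigmaIn (Metric.ball 0 r))
      ((sigmaIn (Metric.ball 0 r)).comap (PointConfig.translate t)) P :=
  indep_of_indep_of_le_right
    (hP.indep_sigmaIn Metric.isOpen_ball.measurableSet
      (measurable_add_const t Metric.isOpen_ball.measurableSet)
      (disjoint_ball_preimage_add_const ht))
    (comap_translate_sigmaIn_le t _)

theorem measurePreserving_vadd_prod (hP : IsPoissonPointProcess l P)
    (hQ : IsPoissonPointProcess l' Q) (z : Fin 2 → ℤ) :
    MeasurePreserving (fun ω : PointConfig × PointConfig => z +ᵥ ω) (P.prod Q) (P.prod Q) := by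
  rw [vadd_prod_eq_map]
  exact (hP.measurePreserving_translate _).prod (hQ.measurePreserving_translate _)

theorem ergodic_vadd_prod (hP : IsPoissonPointProcess l P) (hQ : IsPoissonPointProcess l' Q)
    (i : Fin 2) :
    Ergodic (fun ω : PointConfig × PointConfig => (Pi.single i 1 : Fin 2 → ℤ) +ᵥ ω)
      (P.prod Q) := by
  refine (hP.measurePreserving_vadd_prod hQ _).ergodic_of_indep_comap_iterate
    (F := fun n : ℕ => (sigmaIn (Metric.ball 0 n)).prod (sigmaIn (Metric.ball 0 n)))
    -- A shift by `2 * n` just separates open balls of radius `n`.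
    (fun m n h => ?_) ?_ fun n => ⟨2 * n, ?_⟩
  · have h' : sigmaIn (Metric.ball 0 m) ≤ sigmaIn (Metric.ball 0 n) :=
      sigmaIn_mono (Metric.ball_subset_ball (by exact_mod_cast h))
    exact sup_le_sup (MeasurableSpace.comap_mono h') (MeasurableSpace.comap_mono h')
  · rw [MeasurableSpace.iSup_prod, iSup_sigmaIn_ball]
    rfl
  · have ht : 2 * (n : ℝ) ≤ ‖latticePoint ((2 * n) • Pi.single i 1)‖ := by
      rw [norm_latticePoint_nsmul_single]
      push_cast
      rfl
    rw [vadd_iterate, vadd_prod_eq_map, MeasurableSpace.comap_prodMap]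
    have hle : (sigmaIn (Metric.ball 0 n)).comap
        (PointConfig.translate (latticePoint ((2 * n) • Pi.single i 1))) ≤ PointConfig.instMeasurableSpace :=
      (comap_translate_sigmaIn_le _ _).trans (sigmaIn_le _)
    exact (hP.indep_sigmaIn_comap_translate ht).prod (sigmaIn_le _) hle (sigmaIn_le _) hle
      (hQ.indep_sigmaIn_comap_translate ht)

end IsPoissonPointProcess

theorem mainTheorem9 (lp ls : ℝ≥0) (Pp Ps : Measure PointConfig)
    [IsProbabilityMeasure Pp] [IsProbabilityMeasure Ps]
    (hp : IsPoissonPointProcess lp Pp) (hs : IsPoissonPointProcess ls Ps) :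
    ErgodicVAdd (Fin 2 → ℤ) (PointConfig × PointConfig) (Pp.prod Ps) ∧
      ∀ i : Fin 2, Ergodic
        (fun ω : PointConfig × PointConfig => (Pi.single i 1 : Fin 2 → ℤ) +ᵥ ω) (Pp.prod Ps) := by
  refine ⟨{ measure_preimage_vadd := ?_, aeconst_of_forall_preimage_vadd_ae_eq := ?_ },
    fun i => hp.ergodic_vadd_prod hs i⟩
  · intro z E hE
    exact (hp.measurePreserving_vadd_prod hs z).measure_preimage hE.nullMeasurableSet
  · intro E hE hinv
    rw [eventuallyConst_set']
    -- Almost-everywhere invariance under a single unit translation already suffices.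
    exact (hp.ergodic_vadd_prod hs 0).quasiErgodic.ae_empty_or_univ₀ hE.nullMeasurableSet
      (hinv (Pi.single 0 1))
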